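/- \textbf{Setting.} Fix a universal prefix-free machine $U$ with auxiliary input, i.e. a partial computable map $(p,y)\mapsto U(p,y)$ on binary words whose halting programs form a prefix-free set for each $y$, and which simulates every other such machine at the cost of a constant number of additional program bits. Let $K(x\mid y)$ be the length of a shortest $p$ with $U(p,y)=x$, let $K(x)=K(x\mid\varepsilon)$ with $\varepsilon$ the empty word, and let $z^*$ be a shortest program that outputs $z$, i.e. a shortest $p$ with $U(p,\varepsilon)=z$. Tuples of words are coded as words in a standard way (the empty tuple as $\varepsilon$, a $1$-tuple as its entry), and $\log=\log_2$. A computable distribution or conditional distribution is represented by a binary word describing it, i.e. denoting a program that computes its probabilities to any given precision; inside $K(\cdot)$ and $(\cdot)^*$ the symbols $P_X$, $P_{Y\mid X}$, $P_{X,Y}$ stand for such words. Fix a computable injective map $J$ on pairs of words which sends words describing $P_X$ and $P_{Y\mid X}$ to a word describing the joint distribution $P_{X,Y}$, $P(x,y)=P(x)P(y\mid x)$; this word $J(P_X,P_{Y\mid X})$ represents $P_{X,Y}$. For words $w_1,\dots,w_n$ attached to the nodes of a directed acyclic graph, let $\mathrm{pa}_j$ be the tuple of words attached to the parents of node $j$.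 The algorithmic Markov condition with slack $c$ says $$\Bigl|K(w_1,\dots,w_n)-\sum_{j=1}^n K(w_j\mid \mathrm{pa}_j^*)\Bigr|\le c .$$ For a cause-effect pair $X\to Y$ with observations $x,y$, the graph $G^1$ has the nodes $P_X,\ x,\ P_{Y\mid X},\ y$ and the edges $P_X\to x$, $x\to y$, $P_{Y\mid X}\to y$. Define, with values in $(-\infty,+\infty]$ and $-\log 0=+\infty$, $$\delta(x)=-\log P(x)-K(x\mid (P_X)^*),\qquad \delta(y\mid x)=-\log P(y\mid x)-K(y\mid (x,P_{Y\mid X})^*),$$ $$\delta(x,y)=-\log P(x,y)-K(x,y\mid (P_{X,Y})^*).$$ \textbf{Lemma (Decomposition of randomness deficiency for a cause-effect pair).} For every $c$ there is a constant $C$, depending only on $U$, $J$ and $c$, such that the following holds. Let $\mathcal X,\mathcal Y\subseteq\{0,1\}^*$, let $P_X$ be a distribution on $\mathcal X$ and $P_{Y\mid X}$ a conditional distribution on $\mathcal Y$ given the elements of $\mathcal X$, each represented by a word describing it, and let $x\in\mathcal X$, $y\in\mathcal Y$. If the words $P_X, x, P_{Y\mid X}, y$ satisfy the algorithmic Markov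 condition with slack $c$ for $G^1$, then $$\delta(x,y)\le \delta(x)+\delta(y\mid x)+C\qquad\text{and}\qquad \delta(x)+\delta(y\mid x)\le\delta(x,y)+C .$$ That is, $\delta(x,y)\stackrel{+}{=}\delta(x)+\delta(y\mid x)$ up to an additive constant that does not depend on $x$, $y$, $P_X$ or $P_{Y\mid X}$. -/

import Mathlib

open scoped ENNReal

/-- Binary words. -/
abbrev Word : Type := List Bool

/-! ### Conditional prefix complexity -/

/-- A conditional prefix-free machine: a partial computable map taking a program and an auxiliary
word to an output word, whose set of halting programs is prefix-free for each auxiliary word. -/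
structure IsPrefixMachine (U : Word → Word → Part Word) : Prop where
  partrec : Partrec₂ U
  prefixFree : ∀ y p p' : Word, (U p y).Dom → (U p' y).Dom → p <+: p' → p = p'

/-- A universal prefix-free machine: a prefix-free machine on which every prefix-free machine
can be simulated at the cost of a constant number of additional program bits. -/
structure IsUniversalPrefixMachine (U : Word → Word → Part Word) : Prop where
  isPrefixMachine : IsPrefixMachine U
  universal : ∀ V : Word → Word → Part Word, IsPrefixMachine V →
    ∃ c : ℕ, ∀ p y z : Word, z ∈ V p y → ∃ p' : Word, z ∈ U p' y ∧ p'.length ≤ p.length + c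

/-- The conditional Kolmogorov complexity `K(x | y)` with respect to `U`. -/
noncomputable def condK (U : Word → Word → Part Word) (x y : Word) : ℕ :=
  sInf {l : ℕ | ∃ p : Word, x ∈ U p y ∧ p.length = l}

/-- The Kolmogorov complexity `K(x)`: the auxiliary word is empty. -/
noncomputable def plainK (U : Word → Word → Part Word) (x : Word) : ℕ :=
  condK U x []

/-- `p` is a shortest program that outputs `z`. -/
def IsShortestProgram (U : Word → Word → Part Word) (z p : Word) : Prop :=
  z ∈ U p [] ∧ ∀ p' : Word, z ∈ U p' [] → p.length ≤ p'.length

/-- A (chosen) shortest program `z^*` that outputs `z`. -/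
noncomputable def star (U : Word → Word → Part Word) (z : Word) : Word :=
  Classical.epsilon (IsShortestProgram U z)

/-- The self-delimiting code `1^{|a|} 0 a b` of the pair `(a, b)`. -/
def pairWord (a b : Word) : Word :=
  List.replicate a.length true ++ false :: (a ++ b)

/-- The code of an `n`-tuple of words, by iterated pairing; a `1`-tuple is coded by its entry. -/
def tupleWord : List Word → Word
  | [] => []
  | [a] => a
  | a :: b :: l => pairWord a (tupleWord (b :: l))

/-! ### The algorithmic Markov condition -/

/-- A directed acyclic graph on the nodes `0, …, n - 1`; `adj i j` means that `i` is a parent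
of `j`. -/
structure Dag (n : ℕ) where
  adj : Fin n → Fin n → Prop
  acyclic : ∀ i, ¬ Relation.TransGen adj i i

open Classical in
/-- The word coding the tuple `pa_j` of the words attached to the parents of the node `j`. -/
noncomputable def parentsWord {n : ℕ} (G : Dag n) (w : Fin n → Word) (j : Fin n) : Word :=
  tupleWord (((List.finRange n).filter (fun i => G.adj i j)).map w)

/-- The algorithmic Markov condition with additive slack `c`, for words `w 0, …, w (n - 1)`
whose causal relations are given by `G`:
`K(w_0, …, w_{n-1})` equals `∑_j K(w_j | pa_j^*)` up to `c`. -/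
def AlgorithmicMarkov (U : Word → Word → Part Word) (c : ℝ) {n : ℕ} (G : Dag n)
    (w : Fin n → Word) : Prop :=
  |(plainK U (tupleWord (List.ofFn w)) : ℝ)
    - ∑ j : Fin n, (condK U (w j) (star U (parentsWord G w j)) : ℝ)| ≤ c

/-- The graph `G^1` of a cause-effect pair `X → Y`, with nodes
`0 = P_X`, `1 = x`, `2 = P_{Y|X}`, `3 = y` and edges `P_X → x`, `x → y`, `P_{Y|X} → y`. -/
def causeEffectG1 : Dag 4 where
  adj i j := (i = 0 ∧ j = 1) ∨ (i = 1 ∧ j = 3) ∨ (i = 2 ∧ j = 3)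
  acyclic := by
    have key : ∀ i j : Fin 4, Relation.TransGen
        (fun i j : Fin 4 => (i = 0 ∧ j = 1) ∨ (i = 1 ∧ j = 3) ∨ (i = 2 ∧ j = 3)) i j → i < j := by
      intro i j h
      induction h with
      | single h => rcases h with ⟨rfl, rfl⟩ | ⟨rfl, rfl⟩ | ⟨rfl, rfl⟩ <;> decide
      | tail _ h ih =>
        refine ih.trans ?_
        rcases h with ⟨rfl, rfl⟩ | ⟨rfl, rfl⟩ | ⟨rfl, rfl⟩ <;> decide
    exact fun i h => lt_irrefl i (key i i h)

/-! ### Words describing computable distributions -/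

/-- The usual bijection between binary words and natural numbers (bijective base two). -/
def wordToNat (w : Word) : ℕ :=
  w.foldr (fun b n => 2 * n + (1 + b.toNat)) 0

/-- The program (code of a partial recursive function) denoted by a word. -/
def programOf (w : Word) : Nat.Partrec.Code :=
  Nat.Partrec.Code.ofNatCode (wordToNat w)

/-- The word `w` describes the function `f` (in the input coding `e`): the program denoted by `w`
computes from (the code of) `a` and a precision `n` a natural number `m` such that `m / 2 ^ n`
approximates `f a` up to `1 / 2 ^ n`. -/
def Describes {α : Type} (e : α → ℕ) (w : Word) (f : α → ℝ≥0∞) : Prop :=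
  ∀ (a : α) (n : ℕ), ∃ m ∈ (programOf w).eval (Nat.pair (e a) n),
    |(f a).toReal - (m : ℝ) / 2 ^ n| ≤ 1 / 2 ^ n

/-- The word `p` describes the distribution `P` on `𝒳 ⊆ {0,1}^*`. -/
def DescribesDist {𝒳 : Set Word} (p : Word) (P : PMF 𝒳) : Prop :=
  Describes (fun x : 𝒳 => Encodable.encode (x : Word)) p P

/-- The input coding of pairs of values. -/
def encodePair {𝒳 𝒴 : Set Word} (xy : 𝒳 × 𝒴) : ℕ :=
  Nat.pair (Encodable.encode (xy.1 : Word)) (Encodable.encode (xy.2 : Word))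

/-- The word `q` describes the mechanism `P_{Y|X}`, i.e. the function `(x, y) ↦ P(y | x)`. -/
def DescribesMechanism {𝒳 𝒴 : Set Word} (q : Word) (Q : 𝒳 → PMF 𝒴) : Prop :=
  Describes (encodePair (𝒳 := 𝒳) (𝒴 := 𝒴)) q (fun xy => Q xy.1 xy.2)

/-- The word `r` describes the distribution `R` on `𝒳 × 𝒴`. -/
def DescribesJoint {𝒳 𝒴 : Set Word} (r : Word) (R : PMF (𝒳 × 𝒴)) : Prop :=
  Describes (encodePair (𝒳 := 𝒳) (𝒴 := 𝒴)) r R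

/-- The joint distribution `P_{X,Y}` of cause and effect, generated by `P_X` and `P_{Y|X}`. -/
noncomputable def jointDist {𝒳 𝒴 : Set Word} (P : PMF 𝒳) (Q : 𝒳 → PMF 𝒴) : PMF (𝒳 × 𝒴) :=
  P.bind fun x => (Q x).map fun y => (x, y)

/-- An effective convention for writing down joint distributions of cause-effect pairs as words:
from words `p`, `q` describing `P_X` and `P_{Y|X}`, a word `J p q` describing `P_{X,Y}` is
computed, and distinct pairs of words are kept distinct. -/
structure IsJointDescription (J : Word → Word → Word) : Prop where
  computable : Computable₂ J
  injective : Function.Injective2 J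
  describes : ∀ (𝒳 𝒴 : Set Word) (P : PMF 𝒳) (Q : 𝒳 → PMF 𝒴) (p q : Word),
    DescribesDist p P → DescribesMechanism q Q → DescribesJoint (J p q) (jointDist P Q)

/-! ### Randomness deficiency -/

/-- `-log₂ t`, with value `+∞` at `t = 0`. -/
noncomputable def negLog (t : ℝ≥0∞) : EReal :=
  if t = 0 then ⊤ else ((-Real.logb 2 t.toReal : ℝ) : EReal)

/-- `δ(x) = -log P(x) - K(x | (P_X)^*)`, where `p` is the word describing `P_X`. -/
noncomputable def deficiency (U : Word → Word → Part Word) {𝒳 : Set Word} (P : PMF 𝒳) (p : Word)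
    (x : 𝒳) : EReal :=
  negLog (P x) - (condK U x (star U p) : EReal)

/-- `δ(x, y) = -log P(x, y) - K(x, y | (P_{X,Y})^*)`, where `r` is the word describing
`P_{X,Y}`. -/
noncomputable def jointDeficiency (U : Word → Word → Part Word) {𝒳 𝒴 : Set Word}
    (R : PMF (𝒳 × 𝒴)) (r : Word) (x : 𝒳) (y : 𝒴) : EReal :=
  negLog (R (x, y)) - (condK U (tupleWord [(x : Word), (y : Word)]) (star U r) : EReal)

/-- `δ(y | x) = -log P(y | x) - K(y | (x, P_{Y|X})^*)`, where `q` is the word describing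
`P_{Y|X}`. -/
noncomputable def condDeficiency (U : Word → Word → Part Word) {𝒳 𝒴 : Set Word}
    (Q : 𝒳 → PMF 𝒴) (q : Word) (x : 𝒳) (y : 𝒴) : EReal :=
  negLog (Q x y) - (condK U y (star U (tupleWord [(x : Word), q])) : EReal)

/-! ### Recursively enumerable relations -/

/-! Write `p`, `q` for the words of the two mechanisms. Since `-log P` is additive, the claim is
that `K(x,y | J(p,q)*)` equals `K(x | p*) + K(y | (x,q)*)` up to a constant. As `J` is computable
and injective, `J(p,q)` and the pair `(p,q)` carry the same information, so the chain rule `K(a,b) =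
K(a) + K(b | a*)` turns the left side into `K(p,x,q,y) - K(p,q)`. It is at most the right side by
the chain rule and subadditivity alone: `x` can be generated from `p*`, and `y` from `(x,q)*`. The
converse combines `K(p,q) ≤ K(p) + K(q)` with the Markov condition, which bounds `K(p,x,q,y)` below
by the sum over the nodes.

The weight lies in the hard half of the chain rule, `exists_add_condK_star_le_plainK`. It rests on
the Kraft–Chaitin theorem `exists_condK_le_of_kraft` and on the coding theorem
`exists_sum_mul_two_pow_plainK_le`. Machines are given as recursively enumerable prefix-free
relations, which `exists_condK_le` turns into complexity bounds; enumerability is checked with the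
closure properties of `IsRE`. -/

/-- A recursively enumerable predicate, presented as a projection of a primitive recursive one. -/
def IsRE {α : Type} [Primcodable α] (R : α → Prop) : Prop :=
  ∃ T : α → ℕ → Prop, PrimrecRel T ∧ ∀ a, R a ↔ ∃ n, T a n

namespace IsRE

variable {α β : Type} [Primcodable α] [Primcodable β]

theorem of_primrecPred {R : α → Prop} (h : PrimrecPred R) : IsRE R :=
  ⟨fun a _ => R a, h.comp Primrec.fst, fun a => by simp⟩

theorem comp {R : β → Prop} (h : IsRE R) {f : α → β} (hf : Primrec f) : IsRE fun a => R (f a) := by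
  obtain ⟨T, hT, hR⟩ := h
  exact ⟨fun a n => T (f a) n, hT.comp (hf.comp Primrec.fst) Primrec.snd, fun a => hR _⟩

theorem congr {R S : α → Prop} (h : IsRE R) (e : ∀ a, S a ↔ R a) : IsRE S := by
  obtain ⟨T, hT, hR⟩ := h
  exact ⟨T, hT, fun a => (e a).trans (hR a)⟩

theorem and {R S : α → Prop} (hR : IsRE R) (hS : IsRE S) : IsRE fun a => R a ∧ S a := by
  obtain ⟨T, hT, hR⟩ := hR
  obtain ⟨T', hT', hS⟩ := hS
  refine ⟨fun a n => T a n.unpair.1 ∧ T' a n.unpair.2, ?_, fun a => ?_⟩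
  · exact PrimrecPred.and
      (hT.comp Primrec.fst (Primrec.fst.comp (Primrec.unpair.comp Primrec.snd)))
      (hT'.comp Primrec.fst (Primrec.snd.comp (Primrec.unpair.comp Primrec.snd)))
  · change R a ∧ S a ↔ _
    rw [hR, hS]
    constructor
    · rintro ⟨⟨m, hm⟩, n, hn⟩
      exact ⟨Nat.pair m n, by simpa using ⟨hm, hn⟩⟩
    · rintro ⟨n, hm, hn⟩
      exact ⟨⟨_, hm⟩, _, hn⟩

theorem exists_of_encode {R : α → ℕ → Prop} (h : IsRE fun p : α × ℕ => R p.1 p.2) :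
    IsRE fun a => ∃ n, R a n := by
  obtain ⟨T, hT, hR⟩ := h
  refine ⟨fun a n => T (a, n.unpair.1) n.unpair.2, ?_, fun a => ?_⟩
  · exact hT.comp
      (Primrec.fst.pair (Primrec.fst.comp (Primrec.unpair.comp Primrec.snd)))
      (Primrec.snd.comp (Primrec.unpair.comp Primrec.snd))
  · constructor
    · rintro ⟨m, hm⟩
      obtain ⟨n, hn⟩ := (hR (a, m)).1 hm
      exact ⟨Nat.pair m n, by simpa using hn⟩
    · rintro ⟨n, hn⟩
      exact ⟨_, (hR (a, _)).2 ⟨_, hn⟩⟩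

/-- Step-bounded evaluation `evaln` is primitive recursive, and the bound serves as the existential
witness. -/
theorem mem_partrec {f : α →. β} (hf : Partrec f) : IsRE fun p : α × β => p.2 ∈ f p.1 := by
  obtain ⟨c, hc⟩ := Nat.Partrec.Code.exists_code.1 hf
  refine ⟨fun p n => Nat.Partrec.Code.evaln n c (Encodable.encode p.1)
    = some (Encodable.encode p.2), ?_, fun p => ?_⟩
  · refine Primrec.eq.comp ?_ (Primrec.option_some.comp (Primrec.encode.comp
      (Primrec.snd.comp Primrec.fst)))
    exact Nat.Partrec.Code.primrec_evaln.comp ((Primrec.snd.pair (Primrec.const c)).pair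
      (Primrec.encode.comp (Primrec.fst.comp Primrec.fst)))
  · have : p.2 ∈ f p.1 ↔ Encodable.encode p.2 ∈ c.eval (Encodable.encode p.1) := by
      rw [hc]
      simp [Encodable.encodek]
    exact this.trans Nat.Partrec.Code.evaln_complete

theorem eq_computable {f : α → β} (hf : Computable f) : IsRE fun p : α × β => p.2 = f p.1 :=
  (mem_partrec hf.partrec).congr fun p => by simp

/-- Projection along an arbitrary coded type. -/
theorem ex {R : α → β → Prop} (h : IsRE fun p : α × β => R p.1 p.2) :
    IsRE fun a => ∃ b, R a b := by
  obtain ⟨T, hT, hR⟩ := h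
  have h2 : IsRE fun p : (α × ℕ) × ℕ =>
      ∃ b, Encodable.decode (α := β) p.1.2 = some b ∧ T (p.1.1, b) p.2 := by
    refine of_primrecPred ?_
    classical
    refine PrimrecPred.of_eq (p := fun p : (α × ℕ) × ℕ =>
      ((Encodable.decode (α := β) p.1.2).bind fun b =>
        if T (p.1.1, b) p.2 then some () else none) = some ()) ?_ ?_
    · refine Primrec.eq.comp (Primrec.option_bind (Primrec.decode.comp
        (Primrec.snd.comp Primrec.fst)) ?_) (Primrec.const _)
      refine Primrec.ite (c := fun q : ((α × ℕ) × ℕ) × β => T (q.1.1.1, q.2) q.1.2) ?_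
        (Primrec.const _) (Primrec.const _)
      exact hT.comp ((Primrec.fst.comp (Primrec.fst.comp Primrec.fst)).pair Primrec.snd)
        (Primrec.snd.comp Primrec.fst)
    · intro p
      cases Encodable.decode (α := β) p.1.2 <;> simp
  have h3 := exists_of_encode (R := fun (q : α × ℕ) n =>
    ∃ b, Encodable.decode (α := β) q.2 = some b ∧ T (q.1, b) n) h2
  refine (exists_of_encode (R := fun a m => ∃ n,
    ∃ b, Encodable.decode (α := β) m = some b ∧ T (a, b) n) h3).congr fun a => ?_
  constructor
  · rintro ⟨b, hb⟩
    obtain ⟨n, hn⟩ := (hR (a, b)).1 hb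
    exact ⟨Encodable.encode b, n, b, Encodable.encodek b, hn⟩
  · rintro ⟨m, n, b, -, hn⟩
    exact ⟨b, (hR (a, b)).2 ⟨n, hn⟩⟩

/-- Substituting a merely computable `f` may destroy primitive recursiveness of the matrix, so the
value `b` is guessed and `b = f a` verified. -/
theorem comp_computable {R : β → Prop} (h : IsRE R) {f : α → β} (hf : Computable f) :
    IsRE fun a => R (f a) :=
  (ex (R := fun a b => b = f a ∧ R b) ((eq_computable hf).and (h.comp Primrec.snd))).congr
    fun a => by simp

/-- A recursively enumerable relation has a partial recursive choice function. -/
theorem exists_partrec {R : α → β → Prop} (h : IsRE fun p : α × β => R p.1 p.2) :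
    ∃ f : α →. β, Partrec f ∧ (∀ a, ∀ b ∈ f a, R a b) ∧ ∀ a b, R a b → (f a).Dom := by
  classical
  obtain ⟨T, hT, hR⟩ := h
  -- The search index packs a code of `b` with a witness for `R a b`; the first success is the
  -- value.
  let g : α → ℕ → Option β := fun a n => (Encodable.decode (α := β) n.unpair.1).bind fun b =>
    if T (a, b) n.unpair.2 then some b else none
  have hg : Primrec₂ g := by
    refine Primrec.option_bind (Primrec.decode.comp
      (Primrec.fst.comp (Primrec.unpair.comp Primrec.snd))) ?_
    refine Primrec.ite (c := fun q : (α × ℕ) × β => T (q.1.1, q.2) q.1.2.unpair.2) ?_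
      (Primrec.option_some.comp Primrec.snd) (Primrec.const _)
    exact hT.comp ((Primrec.fst.comp Primrec.fst).pair Primrec.snd)
      (Primrec.snd.comp (Primrec.unpair.comp (Primrec.snd.comp Primrec.fst)))
  refine ⟨fun a => Nat.rfindOpt (g a), Partrec.rfindOpt hg.to_comp, fun a b hb => ?_,
    fun a b hb => ?_⟩
  · obtain ⟨n, hn⟩ := Nat.rfindOpt_spec hb
    simp only [g, Option.mem_def, Option.bind_eq_some_iff] at hn
    obtain ⟨b', -, hb'⟩ := hn
    split_ifs at hb' with ht
    cases hb'
    exact (hR (a, b)).2 ⟨_, ht⟩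
  · obtain ⟨n, hn⟩ := (hR (a, b)).1 hb
    refine Nat.rfindOpt_dom.2 ⟨Nat.pair (Encodable.encode b) n, b, ?_⟩
    simp only [g, Nat.unpair_pair, Encodable.encodek, Option.bind_some, hn, if_true,
      Option.mem_def]

/-- Every recursively enumerable relation can be enumerated without repetition, with the
entry at position `i` having a code at most `i`. -/
theorem exists_enumeration {R : α → β → Prop} (h : IsRE fun p : α × β => R p.1 p.2) :
    ∃ e : α → ℕ → Option β, Primrec₂ e ∧ (∀ a i b, e a i = some b → R a b) ∧
      (∀ a i j b, e a i = some b → e a j = some b → i = j) ∧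
      (∀ a b, R a b → ∃ i, e a i = some b) ∧
      (∀ a i b, e a i = some b → Encodable.encode b ≤ i) := by
  classical
  obtain ⟨T, hT, hR⟩ := h
  -- Keeping only the least witness makes each `b` appear once. Below, `decode₂` accepts only the
  -- canonical code of `b`, for the same reason.
  let T' : α × β → ℕ → Prop := fun p n => T p n ∧ ∀ m < n, ¬ T p m
  have hT' : PrimrecRel T' := by
    refine PrimrecPred.and hT ?_
    have h1 : PrimrecRel fun (m : ℕ) (p : α × β) => ¬ T p m :=
      (hT.comp Primrec.snd Primrec.fst).not
    exact (h1.forall_mem_list.comp (Primrec.list_range.comp Primrec.snd) Primrec.fst).of_eq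
      fun q => by simp
  have huniq : ∀ p m n, T' p m → T' p n → m = n := by
    intro p m n hm hn
    rcases lt_trichotomy m n with h | h | h
    · exact absurd hm.1 (hn.2 _ h)
    · exact h
    · exact absurd hn.1 (hm.2 _ h)
  have hex : ∀ p, (∃ n, T p n) → ∃ n, T' p n := fun p hp =>
    ⟨Nat.find hp, Nat.find_spec hp, fun m hm => Nat.find_min hp hm⟩
  let g : α → ℕ → Option β := fun a n => (Encodable.decode₂ β n.unpair.1).bind fun b =>
    if T' (a, b) n.unpair.2 then some b else none
  have hg : Primrec₂ g := by
    refine Primrec.option_bind (Primrec.decode₂.comp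
      (Primrec.fst.comp (Primrec.unpair.comp Primrec.snd))) ?_
    refine Primrec.ite (c := fun q : (α × ℕ) × β => T' (q.1.1, q.2) q.1.2.unpair.2) ?_
      (Primrec.option_some.comp Primrec.snd) (Primrec.const _)
    exact hT'.comp ((Primrec.fst.comp Primrec.fst).pair Primrec.snd)
      (Primrec.snd.comp (Primrec.unpair.comp (Primrec.snd.comp Primrec.fst)))
  have hspec : ∀ a i b, g a i = some b →
      Encodable.encode b = i.unpair.1 ∧ T' (a, b) i.unpair.2 := by
    intro a i b hb
    simp only [g, Option.bind_eq_some_iff] at hb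
    obtain ⟨b', h1, h2⟩ := hb
    split_ifs at h2 with ht
    cases h2
    exact ⟨Encodable.decode₂_eq_some.1 h1, ht⟩
  refine ⟨g, hg, fun a i b hb => (hR (a, b)).2 ⟨_, (hspec a i b hb).2.1⟩, ?_, ?_, ?_⟩
  · intro a i j b hi hj
    obtain ⟨hi1, hi2⟩ := hspec _ _ _ hi
    obtain ⟨hj1, hj2⟩ := hspec _ _ _ hj
    rw [← Nat.pair_unpair i, ← Nat.pair_unpair j, ← hi1, ← hj1, huniq _ _ _ hi2 hj2]
  · intro a b hb
    obtain ⟨n, hn⟩ := hex _ ((hR (a, b)).1 hb)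
    refine ⟨Nat.pair (Encodable.encode b) n, ?_⟩
    simp only [g, Nat.unpair_pair, Encodable.encodek₂, Option.bind_some, hn, if_true]
  · intro a i b hb
    rw [(hspec a i b hb).1]
    exact Nat.unpair_left_le i

end IsRE

/-! ### Partial sums along an enumeration -/

theorem primrec_two_pow : Primrec fun n : ℕ => 2 ^ n := by
  refine (Primrec.nat_rec₁ (f := fun _ m => 2 * m) 1
    (Primrec.nat_mul.comp (Primrec.const 2) Primrec.snd)).of_eq fun n => ?_
  induction n with
  | zero => rfl
  | succ n ih =>
    simp only at ih ⊢
    rw [ih, pow_succ']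

/-- `N a i / 2 ^ i` is the total weight of the entries listed before position `i`. An integer
numerator suffices because an entry at position `i` has length at most its code, hence at most `i`.
This keeps all comparisons of partial sums primitive recursive. -/
theorem IsRE.exists_partialSums {α β : Type} [Primcodable α] [Primcodable β] {R : α → β → Prop}
    (h : IsRE fun p : α × β => R p.1 p.2) {len : β → ℕ} (hlen : Primrec len)
    (hle : ∀ b, len b ≤ Encodable.encode b) :
    ∃ (e : α → ℕ → Option β) (N : α → ℕ → ℕ), Primrec₂ e ∧ Primrec₂ N ∧
      (∀ a b, R a b ↔ ∃ i, e a i = some b) ∧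
      (∀ a i b, e a i = some b →
        (N a i : ℝ) / 2 ^ i + (1 / 2) ^ len b = (N a (i + 1) : ℝ) / 2 ^ (i + 1)) ∧
      (∀ a, Monotone fun i => (N a i : ℝ) / 2 ^ i) ∧
      (∀ a i, ∃ F : Finset β, (∀ b ∈ F, R a b) ∧
        (N a i : ℝ) / 2 ^ i = ∑ b ∈ F, (1 / 2 : ℝ) ^ len b) ∧
      (∀ a (F : Finset β), (∀ b ∈ F, R a b) →
        ∃ i, ∑ b ∈ F, (1 / 2 : ℝ) ^ len b ≤ (N a i : ℝ) / 2 ^ i) := by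
  classical
  obtain ⟨e, he, hsound, hinj, hcompl, hcode⟩ := h.exists_enumeration
  let step : α → ℕ × ℕ → ℕ := fun a q =>
    2 * q.2 + (Option.casesOn (motive := fun _ => ℕ) (e a q.1) 0 fun b => 2 ^ (q.1 + 1 - len b))
  let N : α → ℕ → ℕ := fun a i => i.rec (motive := fun _ => ℕ) 0 fun n IH => step a (n, IH)
  have hstep : Primrec₂ step := by
    refine Primrec.nat_add.comp (Primrec.nat_mul.comp (Primrec.const 2)
      (Primrec.snd.comp Primrec.snd)) ?_
    refine Primrec.option_casesOn (he.comp Primrec.fst (Primrec.fst.comp Primrec.snd))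
      (Primrec.const 0) ?_
    exact primrec_two_pow.comp (Primrec.nat_sub.comp
      (Primrec.succ.comp (Primrec.fst.comp (Primrec.snd.comp Primrec.fst)))
      (hlen.comp Primrec.snd))
  have hN : Primrec₂ N := Primrec.nat_rec (Primrec.const 0) hstep
  have hsome : ∀ a i b, e a i = some b →
      (N a i : ℝ) / 2 ^ i + (1 / 2) ^ len b = (N a (i + 1) : ℝ) / 2 ^ (i + 1) := by
    intro a i b hb
    have h1 : N a (i + 1) = 2 * N a i + 2 ^ (i + 1 - len b) := by
      change step a (i, N a i) = _
      simp only [step, hb]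
    have h2 : len b ≤ i + 1 := ((hle b).trans (hcode a i b hb)).trans (Nat.le_succ i)
    have h3 : ((2 : ℝ) ^ (i + 1 - len b)) / 2 ^ (i + 1) = (1 / 2) ^ len b := by
      rw [one_div, inv_pow, div_eq_iff (by positivity), eq_comm, inv_mul_eq_iff_eq_mul₀
        (by positivity), ← pow_add, Nat.add_sub_cancel' h2]
    rw [h1, ← h3]
    push_cast
    rw [add_div]
    congr 1
    rw [pow_succ']
    field_simp
  have hnone : ∀ a i, e a i = none →
      (N a (i + 1) : ℝ) / 2 ^ (i + 1) = (N a i : ℝ) / 2 ^ i := by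
    intro a i hb
    have h1 : N a (i + 1) = 2 * N a i := by
      change step a (i, N a i) = _
      simp only [step, hb, add_zero]
    rw [h1, pow_succ']
    push_cast
    field_simp
  -- The set `F` is pinned down exactly for the induction: a new entry is not yet in it, by
  -- non-repetition.
  have hF : ∀ a i, ∃ F : Finset β, (∀ b, b ∈ F ↔ ∃ j < i, e a j = some b) ∧
      (N a i : ℝ) / 2 ^ i = ∑ b ∈ F, (1 / 2 : ℝ) ^ len b := by
    intro a i
    induction i with
    | zero => exact ⟨∅, by simp, by simp [N]⟩
    | succ i ih =>
      obtain ⟨F, hF, hsum⟩ := ih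
      cases hb : e a i with
      | none =>
        refine ⟨F, fun b => ?_, (hnone a i hb).trans hsum⟩
        rw [hF]
        constructor
        · rintro ⟨j, hj, hjb⟩
          exact ⟨j, hj.trans (Nat.lt_succ_self i), hjb⟩
        · rintro ⟨j, hj, hjb⟩
          refine ⟨j, lt_of_le_of_ne (Nat.lt_succ_iff.1 hj) ?_, hjb⟩
          rintro rfl
          simp [hb] at hjb
      | some b₀ =>
        have hnot : b₀ ∉ F := by
          rw [hF]
          rintro ⟨j, hj, hjb⟩
          exact hj.ne (hinj a j i b₀ hjb hb)
        refine ⟨insert b₀ F, fun b => ?_, ?_⟩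
        · rw [Finset.mem_insert, hF]
          constructor
          · rintro (rfl | ⟨j, hj, hjb⟩)
            · exact ⟨i, Nat.lt_succ_self i, hb⟩
            · exact ⟨j, hj.trans (Nat.lt_succ_self i), hjb⟩
          · rintro ⟨j, hj, hjb⟩
            rcases (Nat.lt_succ_iff.1 hj).eq_or_lt with rfl | hlt
            · exact Or.inl (Option.some.inj (hjb.symm.trans hb))
            · exact Or.inr ⟨j, hlt, hjb⟩
        · rw [Finset.sum_insert hnot, ← hsum, ← hsome a i b₀ hb, add_comm]
  refine ⟨e, N, he, hN, fun a b => ⟨hcompl a b, fun ⟨i, hi⟩ => hsound a i b hi⟩, hsome,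
    fun a => monotone_nat_of_le_succ fun i => ?_, fun a i => ?_, fun a F hFR => ?_⟩
  · cases hb : e a i with
    | none => exact (hnone a i hb).ge
    | some b =>
      rw [← hsome a i b hb]
      exact le_add_of_nonneg_right (by positivity)
  · obtain ⟨F, hF, hsum⟩ := hF a i
    exact ⟨F, fun b hb => let ⟨j, _, hj⟩ := (hF b).1 hb; hsound a j b hj, hsum⟩
  · choose! idx hidx using fun b (hb : b ∈ F) => hcompl a b (hFR b hb)
    obtain ⟨F', hF', hsum⟩ := hF a (F.sup idx + 1)
    refine ⟨F.sup idx + 1, hsum ▸ Finset.sum_le_sum_of_subset_of_nonneg (fun b hb => ?_)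
      fun _ _ _ => by positivity⟩
    exact (hF' b).2 ⟨idx b, Nat.lt_succ_of_le (Finset.le_sup hb), hidx b hb⟩

/-! ### Words as dyadic intervals -/

/-- The natural number with binary expansion `p`. -/
def binaryValue (p : Word) : ℕ :=
  p.foldl (fun n b => 2 * n + b.toNat) 0

theorem primrec_binaryValue : Primrec binaryValue := by
  refine Primrec.list_foldl (h := fun _ (q : ℕ × Bool) => 2 * q.1 + q.2.toNat)
    Primrec.id (Primrec.const 0) ?_
  exact Primrec.nat_add.comp (Primrec.nat_mul.comp (Primrec.const 2)
    (Primrec.fst.comp Primrec.snd))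
    ((Primrec.dom_finite Bool.toNat).comp (Primrec.snd.comp Primrec.snd))

theorem binaryValue_concat (p : Word) (b : Bool) :
    binaryValue (p ++ [b]) = 2 * binaryValue p + b.toNat := by
  simp [binaryValue]

theorem binaryValue_append (p s : Word) :
    binaryValue p * 2 ^ s.length ≤ binaryValue (p ++ s) ∧
      binaryValue (p ++ s) + 1 ≤ (binaryValue p + 1) * 2 ^ s.length := by
  induction s using List.reverseRecOn with
  | nil => simp
  | append_singleton s b ih =>
    rw [← List.append_assoc, binaryValue_concat, List.length_append, List.length_singleton,
      pow_succ]
    have := Bool.toNat_le b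
    constructor <;> nlinarith [ih.1, ih.2]

theorem exists_binaryValue_eq (l v : ℕ) (hv : v < 2 ^ l) :
    ∃ p : Word, p.length = l ∧ binaryValue p = v := by
  induction l generalizing v with
  | zero =>
    refine ⟨[], rfl, ?_⟩
    rw [pow_zero, Nat.lt_one_iff] at hv
    exact hv.symm
  | succ l ih =>
    obtain ⟨p, hp, hpv⟩ := ih (v / 2) (by rw [pow_succ] at hv; omega)
    refine ⟨p ++ [decide (v % 2 = 1)], by simp [hp], ?_⟩
    rw [binaryValue_concat, hpv]
    rcases Nat.mod_two_eq_zero_or_one v with h | h <;> simp [h] <;> omega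

/-- A word `p` stands for the interval of reals whose binary expansion starts with `p`; extending
the word shrinks the interval. -/
theorem binaryValue_div_le_of_prefix {p p' : Word} (h : p <+: p') :
    (binaryValue p : ℝ) / 2 ^ p.length ≤ binaryValue p' / 2 ^ p'.length ∧
      (binaryValue p' + 1 : ℝ) / 2 ^ p'.length ≤ (binaryValue p + 1) / 2 ^ p.length := by
  obtain ⟨s, rfl⟩ := h
  obtain ⟨h1, h2⟩ := binaryValue_append p s
  have h1' : (binaryValue p : ℝ) * 2 ^ s.length ≤ binaryValue (p ++ s) := by exact_mod_cast h1
  have h2' : (binaryValue (p ++ s) : ℝ) + 1 ≤ (binaryValue p + 1) * 2 ^ s.length := by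
    exact_mod_cast h2
  rw [List.length_append, pow_add]
  constructor
  · rw [div_le_div_iff₀ (by positivity) (by positivity)]
    nlinarith [pow_pos (two_pos : (0 : ℝ) < 2) p.length]
  · rw [div_le_div_iff₀ (by positivity) (by positivity)]
    nlinarith [pow_pos (two_pos : (0 : ℝ) < 2) p.length]

/-- Every interval `[s, s + 2^{-l}]` in the unit interval contains the dyadic interval of a word
of length `l + 1`. -/
theorem exists_word_in_interval {s t : ℝ} (l : ℕ) (hs : 0 ≤ s) (hst : s + (1 / 2) ^ l = t)
    (ht : t ≤ 1) : ∃ p : Word, p.length = l + 1 ∧ s ≤ binaryValue p / 2 ^ p.length ∧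
      (binaryValue p + 1 : ℝ) / 2 ^ p.length ≤ t := by
  have hpos : (0 : ℝ) < 2 ^ (l + 1) := by positivity
  have hmul : (1 / 2 : ℝ) ^ l * 2 ^ (l + 1) = 2 := by
    rw [pow_succ, ← mul_assoc, ← mul_pow]
    norm_num
  -- The interval is two grid cells of mesh `2^{-(l+1)}` long, and rounding `s` up to the grid costs
  -- less than one.
  have hceil := Nat.ceil_lt_add_one (a := s * 2 ^ (l + 1)) (by positivity)
  have hbound : (⌈s * 2 ^ (l + 1)⌉₊ + 1 : ℝ) ≤ t * 2 ^ (l + 1) := by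
    rw [← hst, add_mul, hmul]
    linarith
  obtain ⟨p, hp, hpv⟩ := exists_binaryValue_eq (l + 1) ⌈s * 2 ^ (l + 1)⌉₊ (by
    have : (⌈s * 2 ^ (l + 1)⌉₊ + 1 : ℝ) ≤ 2 ^ (l + 1) :=
      hbound.trans (mul_le_of_le_one_left hpos.le ht)
    have h' : ⌈s * 2 ^ (l + 1)⌉₊ + 1 ≤ 2 ^ (l + 1) := by exact_mod_cast this
    omega)
  refine ⟨p, hp, ?_, ?_⟩
  · rw [hp, hpv, le_div_iff₀ hpos]
    exact Nat.le_ceil _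
  · rw [hp, hpv, div_le_iff₀ hpos]
    exact hbound

theorem length_le_encode (w : Word) : w.length ≤ Encodable.encode w := by
  induction w with
  | nil => simp
  | cons b w ih =>
    rw [List.length_cons, Encodable.encode_list_cons]
    exact Nat.succ_le_succ (ih.trans (Nat.right_le_pair _ _))

/-- The Kraft inequality for prefix-free sets of words. -/
theorem kraft_of_prefixFree (F : Finset Word)
    (hF : ∀ p ∈ F, ∀ p' ∈ F, p <+: p' → p = p') : ∑ p ∈ F, (1 / 2 : ℝ) ^ p.length ≤ 1 := by
  -- A code containing the empty word is not uniquely decodable, but prefix-freeness then leaves no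
  -- other word.
  by_cases hnil : [] ∈ F
  · have : F = {[]} := by
      ext p
      rw [Finset.mem_singleton]
      exact ⟨fun hp => (hF [] hnil p hp p.nil_prefix).symm, fun h => h ▸ hnil⟩
    simp [this]
  -- The first codewords of two equal concatenations are comparable prefixes, hence equal, and can
  -- be cancelled.
  · have hud : InformationTheory.UniquelyDecodable (F : Set Word) := by
      intro L₁
      induction L₁ with
      | nil =>
        intro L₂ _ h2 h
        cases L₂ with
        | nil => rfl
        | cons b L₂ =>
          have hb : b = [] := by
            have := h.symm
            simp only [List.flatten_cons, List.flatten_nil, List.append_eq_nil_iff] at this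
            exact this.1
          exact absurd (hb ▸ h2 b List.mem_cons_self) hnil
      | cons a L₁ ih =>
        intro L₂ h1 h2 h
        cases L₂ with
        | nil =>
          have ha : a = [] := by
            simp only [List.flatten_cons, List.flatten_nil, List.append_eq_nil_iff] at h
            exact h.1
          exact absurd (ha ▸ h1 a List.mem_cons_self) hnil
        | cons b L₂ =>
          have ha := h1 a List.mem_cons_self
          have hb := h2 b List.mem_cons_self
          rw [List.flatten_cons, List.flatten_cons] at h
          have hab : a = b := by
            rcases List.prefix_or_prefix_of_prefix (List.prefix_append a L₁.flatten)
              (h ▸ List.prefix_append b L₂.flatten) with hp | hp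
            · exact hF a ha b hb hp
            · exact (hF b hb a ha hp).symm
          subst hab
          rw [ih L₂ (fun w hw => h1 w (List.mem_cons_of_mem _ hw))
            (fun w hw => h2 w (List.mem_cons_of_mem _ hw)) (List.append_cancel_left h)]
    simpa using InformationTheory.kraft_mcmillan_inequality hud

/-! ### Pairing of words -/

theorem pairWord_append (a b s : Word) : pairWord a b ++ s = pairWord a (b ++ s) := by
  simp [pairWord]

theorem pairWord_injective2 : Function.Injective2 pairWord := by
  intro a a' b b' h
  have hlen : ∀ (m n : ℕ) (u v : Word), List.replicate m true ++ false :: u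
      = List.replicate n true ++ false :: v → m = n ∧ u = v := by
    intro m
    induction m with
    | zero =>
      rintro (_ | n) u v h
      · simpa using h
      · simp [List.replicate_succ] at h
    | succ m ih =>
      rintro (_ | n) u v h
      · simp [List.replicate_succ] at h
      · rw [List.replicate_succ, List.replicate_succ, List.cons_append, List.cons_append,
          List.cons.injEq] at h
        obtain ⟨rfl, h'⟩ := ih n u v h.2
        exact ⟨rfl, h'⟩
  obtain ⟨h1, h2⟩ := hlen _ _ _ _ h
  exact List.append_inj h2 h1

theorem primrec_pairWord : Primrec₂ pairWord := by
  have hrep : Primrec fun n : ℕ => List.replicate n true := by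
    refine (Primrec.nat_rec₁ (f := fun _ l => true :: l) []
      (Primrec.list_cons.comp (Primrec.const true) Primrec.snd)).of_eq fun n => ?_
    induction n with
    | zero => rfl
    | succ n ih =>
      simp only at ih ⊢
      rw [ih, List.replicate_succ]
  exact Primrec.list_append.comp (hrep.comp (Primrec.list_length.comp Primrec.fst))
    (Primrec.list_cons.comp (Primrec.const false)
      (Primrec.list_append.comp Primrec.fst Primrec.snd))

/-! ### Upper bounds on complexity -/

theorem condK_le {U : Word → Word → Part Word} {p y z : Word} (h : z ∈ U p y) :
    condK U z y ≤ p.length :=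
  Nat.sInf_le ⟨p, h, rfl⟩

theorem IsPrefixMachine.eq_of_prefix {U : Word → Word → Part Word} (hU : IsPrefixMachine U)
    {p p' y z z' : Word} (h : z ∈ U p y) (h' : z' ∈ U p' y) (hp : p <+: p') : p = p' ∧ z = z' := by
  have := hU.prefixFree y p p' (Part.dom_iff_mem.2 ⟨z, h⟩) (Part.dom_iff_mem.2 ⟨z', h'⟩) hp
  subst this
  exact ⟨rfl, Part.mem_unique h h'⟩

theorem IsPrefixMachine.isRE {U : Word → Word → Part Word} (hU : IsPrefixMachine U) :
    IsRE fun q : (Word × Word) × Word => q.2 ∈ U q.1.1 q.1.2 :=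
  IsRE.mem_partrec hU.partrec

namespace IsUniversalPrefixMachine

variable {U : Word → Word → Part Word} (hU : IsUniversalPrefixMachine U)
include hU

/-- Recursively enumerable prefix-free machines are simulated. -/
theorem exists_simulation {R : Word × Word → Word → Prop}
    (hR : IsRE fun q : (Word × Word) × Word => R q.1 q.2)
    (hpf : ∀ y p p' z z', R (p, y) z → R (p', y) z' → p <+: p' → p = p' ∧ z = z') :
    ∃ c : ℕ, ∀ p y z, R (p, y) z → ∃ p', z ∈ U p' y ∧ p'.length ≤ p.length + c := by
  obtain ⟨f, hf, hsound, hdom⟩ := hR.exists_partrec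
  obtain ⟨c, hc⟩ := hU.universal (fun p y => f (p, y)) ⟨hf, fun y p p' h h' hp =>
    (hpf y p p' _ _ (hsound _ _ (Part.get_mem h)) (hsound _ _ (Part.get_mem h')) hp).1⟩
  refine ⟨c, fun p y z h => hc p y z ?_⟩
  -- The choice function might pick another output, but `hpf` with equal programs makes outputs
  -- unique.
  obtain ⟨z', hz'⟩ := Part.dom_iff_mem.1 (hdom _ _ h)
  rwa [(hpf y p p z z' h (hsound _ _ hz') (List.prefix_refl p)).2]

theorem exists_condK_le {R : Word × Word → Word → Prop}
    (hR : IsRE fun q : (Word × Word) × Word => R q.1 q.2)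
    (hpf : ∀ y p p' z z', R (p, y) z → R (p', y) z' → p <+: p' → p = p' ∧ z = z') :
    ∃ c : ℕ, ∀ p y z, R (p, y) z → condK U z y ≤ p.length + c := by
  obtain ⟨c, hc⟩ := hU.exists_simulation hR hpf
  refine ⟨c, fun p y z h => ?_⟩
  obtain ⟨p', hp', hl⟩ := hc p y z h
  exact (condK_le hp').trans hl

/-- Ensures that the infimum in `condK` is attained and is not the default `0` of an empty set. The
machine prints `z` from its self-delimiting code. -/
theorem exists_program (z y : Word) : ∃ p, z ∈ U p y := by
  obtain ⟨c, hc⟩ := hU.exists_simulation (R := fun q z => q.1 = pairWord z [])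
    (IsRE.of_primrecPred (Primrec.eq.comp (Primrec.fst.comp Primrec.fst)
      (primrec_pairWord.comp Primrec.snd (Primrec.const [])))) (by
      rintro y _ _ z z' rfl rfl ⟨s, hs⟩
      rw [pairWord_append] at hs
      obtain ⟨rfl, -⟩ := pairWord_injective2 hs
      exact ⟨rfl, rfl⟩)
  obtain ⟨p, hp, -⟩ := hc _ y z rfl
  exact ⟨p, hp⟩

theorem exists_length_eq_condK (z y : Word) : ∃ p, z ∈ U p y ∧ p.length = condK U z y := by
  obtain ⟨p, hp⟩ := hU.exists_program z y
  exact Nat.sInf_mem (s := {l : ℕ | ∃ p : Word, z ∈ U p y ∧ p.length = l}) ⟨_, p, hp, rfl⟩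

theorem isShortestProgram_star (z : Word) : IsShortestProgram U z (star U z) := by
  refine Classical.epsilon_spec (p := IsShortestProgram U z) ?_
  obtain ⟨p, hp, hl⟩ := hU.exists_length_eq_condK z []
  exact ⟨p, hp, fun p' hp' => hl ▸ condK_le hp'⟩

theorem star_mem (z : Word) : z ∈ U (star U z) [] :=
  (hU.isShortestProgram_star z).1

theorem length_star (z : Word) : (star U z).length = plainK U z := by
  obtain ⟨p, hp, hl⟩ := hU.exists_length_eq_condK z []
  exact le_antisymm (((hU.isShortestProgram_star z).2 p hp).trans hl.le)
    (condK_le (hU.star_mem z))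

/-- The complexity is monotone, up to a constant, under computable functions. -/
theorem exists_plainK_le {α : Type} [Primcodable α] {F G : α → Word} (hF : Computable F)
    (hG : Computable G) (hinj : Function.Injective F) :
    ∃ c : ℕ, ∀ a, plainK U (G a) ≤ plainK U (F a) + c := by
  -- The machine runs a program for `F a`, searches for `a`, and prints `G a`; injectivity of `F`
  -- makes the output unique.
  let R : Word × Word → Word → Prop := fun q z => q.2 = [] ∧ ∃ a, F a ∈ U q.1 [] ∧ z = G a
  obtain ⟨c, hc⟩ := hU.exists_condK_le (R := R) (by
    refine IsRE.and (IsRE.of_primrecPred (Primrec.eq.comp (Primrec.snd.comp Primrec.fst)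
      (Primrec.const []))) (IsRE.ex (R := fun (q : (Word × Word) × Word) a =>
        F a ∈ U q.1.1 [] ∧ q.2 = G a) (IsRE.and ?_ ?_))
    · exact hU.isPrefixMachine.isRE.comp_computable
        (f := fun q : ((Word × Word) × Word) × α => ((q.1.1.1, []), F q.2))
        (((Computable.fst.comp (Computable.fst.comp Computable.fst)).pair
          (Computable.const [])).pair (hF.comp Computable.snd))
    · exact (IsRE.eq_computable hG).comp
        (f := fun q : ((Word × Word) × Word) × α => (q.2, q.1.2))
        (Primrec.snd.pair (Primrec.snd.comp Primrec.fst))) (by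
    rintro y p p' _ _ ⟨rfl, a, ha, rfl⟩ ⟨-, a', ha', rfl⟩ hp
    obtain ⟨rfl, h⟩ := hU.isPrefixMachine.eq_of_prefix ha ha' hp
    rw [hinj h]
    exact ⟨rfl, rfl⟩)
  refine ⟨c, fun a => ?_⟩
  obtain ⟨p, hp, hl⟩ := hU.exists_length_eq_condK (F a) []
  exact (hc p [] (G a) ⟨rfl, a, hp, rfl⟩).trans_eq (by rw [hl]; rfl)

/-- Two programs can be run one after the other, the auxiliary word of the second one being
computed from that of the first one and from the first program. -/
theorem exists_condK_pairWord_le {h : Word × Word → Word} (hh : Computable h) :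
    ∃ c : ℕ, ∀ y p a b, a ∈ U p y →
      condK U (pairWord a b) y ≤ p.length + condK U b (h (y, p)) + c := by
  -- The cut between the two programs needs no marker: halting programs for one auxiliary word are
  -- prefix-free, so the first part is determined.
  let R : Word × Word → Word → Prop := fun q z =>
    ∃ w : (Word × Word) × (Word × Word), w.2.1 ∈ U w.1.1 q.2 ∧ w.2.2 ∈ U w.1.2 (h (q.2, w.1.1)) ∧
      q.1 = w.1.1 ++ w.1.2 ∧ z = pairWord w.2.1 w.2.2
  obtain ⟨c, hc⟩ := hU.exists_condK_le (R := R) (by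
    refine IsRE.ex (R := fun (q : (Word × Word) × Word) (w : (Word × Word) × (Word × Word)) =>
      w.2.1 ∈ U w.1.1 q.1.2 ∧ w.2.2 ∈ U w.1.2 (h (q.1.2, w.1.1)) ∧
      q.1.1 = w.1.1 ++ w.1.2 ∧ q.2 = pairWord w.2.1 w.2.2) ?_
    have hy : Primrec fun r : ((Word × Word) × Word) × ((Word × Word) × (Word × Word)) =>
        r.1.1.2 := Primrec.snd.comp (Primrec.fst.comp Primrec.fst)
    have hp1 : Primrec fun r : ((Word × Word) × Word) × ((Word × Word) × (Word × Word)) =>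
        r.2.1.1 := Primrec.fst.comp (Primrec.fst.comp Primrec.snd)
    have hp2 : Primrec fun r : ((Word × Word) × Word) × ((Word × Word) × (Word × Word)) =>
        r.2.1.2 := Primrec.snd.comp (Primrec.fst.comp Primrec.snd)
    have ha : Primrec fun r : ((Word × Word) × Word) × ((Word × Word) × (Word × Word)) =>
        r.2.2.1 := Primrec.fst.comp (Primrec.snd.comp Primrec.snd)
    have hb : Primrec fun r : ((Word × Word) × Word) × ((Word × Word) × (Word × Word)) =>
        r.2.2.2 := Primrec.snd.comp (Primrec.snd.comp Primrec.snd)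
    refine IsRE.and ?_ (IsRE.and ?_ (IsRE.and ?_ ?_))
    · exact hU.isPrefixMachine.isRE.comp ((hp1.pair hy).pair ha)
    · exact hU.isPrefixMachine.isRE.comp_computable
        ((hp2.to_comp.pair (hh.comp (hy.pair hp1).to_comp)).pair hb.to_comp)
    · exact IsRE.of_primrecPred (Primrec.eq.comp (Primrec.fst.comp (Primrec.fst.comp Primrec.fst))
        (Primrec.list_append.comp hp1 hp2))
    · exact IsRE.of_primrecPred (Primrec.eq.comp (Primrec.snd.comp Primrec.fst)
        (primrec_pairWord.comp ha hb))) (by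
    rintro y p p' z z' ⟨⟨⟨p₁, p₂⟩, a, b⟩, ha, hb, hp, rfl⟩ ⟨⟨⟨p₁', p₂'⟩, a', b'⟩, ha', hb', hp', rfl⟩
      hpre
    simp only at ha hb hp ha' hb' hp' ⊢
    subst hp hp'
    have h1 : p₁ = p₁' ∧ a = a' := by
      rcases List.prefix_or_prefix_of_prefix ((List.prefix_append p₁ p₂).trans hpre)
        (List.prefix_append p₁' p₂') with hq | hq
      · exact hU.isPrefixMachine.eq_of_prefix ha ha' hq
      · exact (hU.isPrefixMachine.eq_of_prefix ha' ha hq).imp Eq.symm Eq.symm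
    obtain ⟨rfl, rfl⟩ := h1
    obtain ⟨rfl, rfl⟩ := hU.isPrefixMachine.eq_of_prefix hb hb'
      ((List.prefix_append_right_inj p₁).1 hpre)
    exact ⟨rfl, rfl⟩)
  refine ⟨c, fun y p a b ha => ?_⟩
  obtain ⟨p', hp', hl⟩ := hU.exists_length_eq_condK b (h (y, p))
  rw [← hl, ← List.length_append]
  exact hc _ y _ ⟨((p, p'), (a, b)), ha, hp', rfl, rfl⟩

theorem exists_condK_pairWord_le_add :
    ∃ c : ℕ, ∀ a b y, condK U (pairWord a b) y ≤ condK U a y + condK U b y + c := by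
  obtain ⟨c, hc⟩ := hU.exists_condK_pairWord_le (h := Prod.fst) Computable.fst
  refine ⟨c, fun a b y => ?_⟩
  obtain ⟨p, hp, hl⟩ := hU.exists_length_eq_condK a y
  exact hl ▸ hc y p a b hp

/-- The easy half of the chain rule: when the first program is `a*`, it is itself the auxiliary word
that the second program needs. -/
theorem exists_plainK_pairWord_le_star :
    ∃ c : ℕ, ∀ a b, plainK U (pairWord a b) ≤ plainK U a + condK U b (star U a) + c := by
  obtain ⟨c, hc⟩ := hU.exists_condK_pairWord_le (h := Prod.snd) Computable.snd
  refine ⟨c, fun a b => ?_⟩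
  have := hc [] (star U a) a b (hU.star_mem a)
  rwa [hU.length_star] at this

/-- A fixed auxiliary word changes the complexity by at most a constant. -/
theorem exists_condK_le_condK_const (s t : Word) :
    ∃ c : ℕ, ∀ z, condK U z t ≤ condK U z s + c := by
  obtain ⟨c, hc⟩ := hU.exists_condK_le (R := fun q z => z ∈ U q.1 s)
    (hU.isPrefixMachine.isRE.comp (f := fun q : (Word × Word) × Word => ((q.1.1, s), q.2))
      (((Primrec.fst.comp Primrec.fst).pair (Primrec.const s)).pair Primrec.snd))
    (fun y p p' z z' h h' hp => hU.isPrefixMachine.eq_of_prefix h h' hp)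
  refine ⟨c, fun z => ?_⟩
  obtain ⟨p, hp, hl⟩ := hU.exists_length_eq_condK z s
  exact hl ▸ hc p t z hp

end IsUniversalPrefixMachine

/-! ### Kraft–Chaitin, the coding theorem and the chain rule -/

theorem sum_half_pow_le (A : Finset ℕ) (m : ℕ) (hA : ∀ n ∈ A, m + 1 ≤ n) :
    ∑ n ∈ A, (1 / 2 : ℝ) ^ n ≤ (1 / 2) ^ m := by
  have hsum : ∀ j, ∑ n ∈ Finset.Ico (m + 1) (m + 1 + j), (1 / 2 : ℝ) ^ n
      = (1 / 2) ^ m - (1 / 2) ^ (m + j) := by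
    intro j
    induction j with
    | zero => simp
    | succ j ih =>
      rw [← add_assoc, Finset.sum_Ico_succ_top (Nat.le_add_right _ _), ih]
      have : (1 / 2 : ℝ) ^ (m + j) = 2 * (1 / 2) ^ (m + 1 + j) := by
        rw [show m + 1 + j = m + j + 1 by omega, pow_succ]
        ring
      rw [this, show m + (j + 1) = m + 1 + j by omega]
      ring
  calc ∑ n ∈ A, (1 / 2 : ℝ) ^ n
      ≤ ∑ n ∈ Finset.Ico (m + 1) (m + 1 + A.sup id), (1 / 2 : ℝ) ^ n := by
        refine Finset.sum_le_sum_of_subset_of_nonneg (fun n hn => ?_) fun _ _ _ => by positivity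
        have : n ≤ A.sup id := Finset.le_sup (f := id) hn
        exact Finset.mem_Ico.2 ⟨hA n hn, by omega⟩
    _ ≤ (1 / 2) ^ m := by
        rw [hsum]
        exact sub_le_self _ (by positivity)

namespace IsUniversalPrefixMachine

variable {U : Word → Word → Part Word} (hU : IsUniversalPrefixMachine U)
include hU

/-- The Kraft–Chaitin theorem: requests `(l, b)` that are enumerated uniformly in the auxiliary
word and satisfy the Kraft inequality are met by programs. -/
theorem exists_condK_le_of_kraft {R : Word → ℕ × Word → Prop}
    (hR : IsRE fun q : Word × (ℕ × Word) => R q.1 q.2) :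
    ∃ c : ℕ, ∀ y, (∀ F : Finset (ℕ × Word), (∀ r ∈ F, R y r) →
      ∑ r ∈ F, (1 / 2 : ℝ) ^ r.1 ≤ 1) → ∀ l b, R y (l, b) → condK U b y ≤ l + c := by
  obtain ⟨e, N, he, hN, hRe, hstep, hmono, hfin, -⟩ := hR.exists_partialSums
    (len := Prod.fst) Primrec.fst (fun b => Nat.left_le_pair _ _)
  -- The request at position `i` owns the interval between consecutive partial sums, of length
  -- `2^{-l}`. Its programs are the words of length `l + 1` whose dyadic interval fits inside;
  -- `hreal` undoes the clearing of denominators.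
  let R' : Word × Word → Word → Prop := fun q z => ∃ w : ℕ × ℕ, e q.2 w.1 = some (w.2, z) ∧
    q.1.length = w.2 + 1 ∧ N q.2 w.1 * 2 ^ q.1.length ≤ binaryValue q.1 * 2 ^ w.1 ∧
    (binaryValue q.1 + 1) * 2 ^ (w.1 + 1) ≤ N q.2 (w.1 + 1) * 2 ^ q.1.length
  have hreal : ∀ p y z, R' (p, y) z ↔ ∃ i l, e y i = some (l, z) ∧ p.length = l + 1 ∧
      (N y i : ℝ) / 2 ^ i ≤ binaryValue p / 2 ^ p.length ∧
      (binaryValue p + 1 : ℝ) / 2 ^ p.length ≤ (N y (i + 1) : ℝ) / 2 ^ (i + 1) := by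
    intro p y z
    simp only [R', Prod.exists]
    refine exists_congr fun i => exists_congr fun l => and_congr_right fun _ =>
      and_congr_right fun _ => ?_
    rw [div_le_div_iff₀ (by positivity) (by positivity),
      div_le_div_iff₀ (by positivity) (by positivity)]
    norm_cast
  obtain ⟨c, hc⟩ := hU.exists_condK_le (R := R') (by
    refine IsRE.ex (R := fun (q : (Word × Word) × Word) (w : ℕ × ℕ) =>
      e q.1.2 w.1 = some (w.2, q.2) ∧
      q.1.1.length = w.2 + 1 ∧ N q.1.2 w.1 * 2 ^ q.1.1.length ≤ binaryValue q.1.1 * 2 ^ w.1 ∧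
      (binaryValue q.1.1 + 1) * 2 ^ (w.1 + 1) ≤ N q.1.2 (w.1 + 1) * 2 ^ q.1.1.length) ?_
    have hy : Primrec fun r : ((Word × Word) × Word) × (ℕ × ℕ) => r.1.1.2 :=
      Primrec.snd.comp (Primrec.fst.comp Primrec.fst)
    have hp : Primrec fun r : ((Word × Word) × Word) × (ℕ × ℕ) => r.1.1.1 :=
      Primrec.fst.comp (Primrec.fst.comp Primrec.fst)
    have hi : Primrec fun r : ((Word × Word) × Word) × (ℕ × ℕ) => r.2.1 :=
      Primrec.fst.comp Primrec.snd
    have hl : Primrec fun r : ((Word × Word) × Word) × (ℕ × ℕ) => r.2.2 :=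
      Primrec.snd.comp Primrec.snd
    have hlen := Primrec.list_length.comp hp
    have hval := primrec_binaryValue.comp hp
    refine IsRE.of_primrecPred (PrimrecPred.and ?_ (PrimrecPred.and ?_ (PrimrecPred.and ?_ ?_)))
    · exact Primrec.eq.comp (he.comp hy hi) (Primrec.option_some.comp
        (hl.pair (Primrec.snd.comp Primrec.fst)))
    · exact Primrec.eq.comp hlen (Primrec.succ.comp hl)
    · exact Primrec.nat_le.comp
        (Primrec.nat_mul.comp (hN.comp hy hi) (primrec_two_pow.comp hlen))
        (Primrec.nat_mul.comp hval (primrec_two_pow.comp hi))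
    · exact Primrec.nat_le.comp
        (Primrec.nat_mul.comp (Primrec.succ.comp hval)
          (primrec_two_pow.comp (Primrec.succ.comp hi)))
        (Primrec.nat_mul.comp (hN.comp hy (Primrec.succ.comp hi)) (primrec_two_pow.comp hlen)))
    -- Intervals of different positions do not overlap, so prefix-freeness holds for every `y`. The
    -- Kraft bound is needed only later, to keep the intervals of a given `y` inside the unit
    -- interval.
    (by
      intro y p p' z z' h h' hpre
      obtain ⟨i, l, hi, hl, h1, h2⟩ := (hreal p y z).1 h
      obtain ⟨j, l', hj, hl', h1', h2'⟩ := (hreal p' y z').1 h'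
      obtain ⟨hle, hle'⟩ := binaryValue_div_le_of_prefix hpre
      have hlt : ∀ w : Word, (binaryValue w : ℝ) / 2 ^ w.length
          < (binaryValue w + 1) / 2 ^ w.length := fun w =>
        div_lt_div_of_pos_right (lt_add_one _) (by positivity)
      rcases lt_trichotomy i j with hij | rfl | hij
      · have := hmono y (Nat.succ_le_of_lt hij)
        simp only [Nat.succ_eq_add_one] at this
        linarith [hlt p']
      · obtain ⟨rfl, rfl⟩ := Prod.mk.inj (Option.some.inj (hi.symm.trans hj))
        exact ⟨hpre.eq_of_length (hl.trans hl'.symm), rfl⟩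
      · have := hmono y (Nat.succ_le_of_lt hij)
        simp only [Nat.succ_eq_add_one] at this
        linarith [hlt p'])
  refine ⟨1 + c, fun y hy l b hb => ?_⟩
  obtain ⟨i, hi⟩ := (hRe y (l, b)).1 hb
  obtain ⟨F, hF, hsum⟩ := hfin y (i + 1)
  obtain ⟨p, hp, h1, h2⟩ := exists_word_in_interval l (by positivity) (hstep y i _ hi)
    (hsum.trans_le (hy F hF))
  have := hc p y b ((hreal p y b).2 ⟨i, l, hi, hp, h1, h2⟩)
  omega

/-- The coding theorem: the total weight of the programs of a prefix-free machine for an output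
is, up to a constant factor, at most the weight of a shortest program. -/
theorem exists_sum_mul_two_pow_plainK_le {W : Word → Word → Prop}
    (hW : IsRE fun q : Word × Word => W q.1 q.2)
    (hpf : ∀ p p' a a', W a p → W a' p' → p <+: p' → p = p' ∧ a = a') :
    ∃ c : ℕ, ∀ a (F : Finset Word), (∀ p ∈ F, W a p) →
      (∑ p ∈ F, (1 / 2 : ℝ) ^ p.length) * 2 ^ plainK U a ≤ 2 ^ c := by
  classical
  obtain ⟨-, N, -, hN, -, -, -, hfin, hcof⟩ := hW.exists_partialSums
    (len := List.length) Primrec.list_length length_le_encode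
  -- A program of length `k + 1` for `a` is requested once the enumerated weight of `a` reaches
  -- `2^{-k}`.
  let R : Word → ℕ × Word → Prop := fun _ r =>
    ∃ w : ℕ × ℕ, r.1 = w.1 + 1 ∧ 2 ^ w.2 ≤ N r.2 w.2 * 2 ^ w.1
  have hreal : ∀ y r, R y r ↔ ∃ k i, r.1 = k + 1 ∧ (1 / 2 : ℝ) ^ k ≤ (N r.2 i : ℝ) / 2 ^ i := by
    intro y r
    simp only [R, Prod.exists]
    refine exists_congr fun k => exists_congr fun i => and_congr_right fun _ => ?_
    rw [one_div, inv_pow, inv_eq_one_div, div_le_div_iff₀ (by positivity) (by positivity), one_mul]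
    norm_cast
  obtain ⟨c, hc⟩ := hU.exists_condK_le_of_kraft (R := R) (by
    refine IsRE.ex (R := fun (q : Word × (ℕ × Word)) (w : ℕ × ℕ) =>
      q.2.1 = w.1 + 1 ∧ 2 ^ w.2 ≤ N q.2.2 w.2 * 2 ^ w.1) ?_
    refine IsRE.of_primrecPred (PrimrecPred.and ?_ ?_)
    · exact Primrec.eq.comp (Primrec.fst.comp (Primrec.snd.comp Primrec.fst))
        (Primrec.succ.comp (Primrec.fst.comp Primrec.snd))
    · exact Primrec.nat_le.comp (primrec_two_pow.comp (Primrec.snd.comp Primrec.snd))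
        (Primrec.nat_mul.comp
          (hN.comp (Primrec.snd.comp (Primrec.snd.comp Primrec.fst))
            (Primrec.snd.comp Primrec.snd))
          (primrec_two_pow.comp (Primrec.fst.comp Primrec.snd))))
  have hkraft : ∀ F : Finset (ℕ × Word), (∀ r ∈ F, R [] r) →
      ∑ r ∈ F, (1 / 2 : ℝ) ^ r.1 ≤ 1 := by
    intro F hF
    -- The requests for one `a` have distinct lengths, so they sum to at most twice the largest,
    -- which enumerated programs of `a` pay for.
    have hG : ∀ a ∈ F.image Prod.snd, ∃ G : Finset Word, (∀ p ∈ G, W a p) ∧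
        ∑ r ∈ F with r.2 = a, (1 / 2 : ℝ) ^ r.1 ≤ ∑ p ∈ G, (1 / 2 : ℝ) ^ p.length := by
      intro a ha
      have hne : (F.filter fun r => r.2 = a).Nonempty := by
        obtain ⟨r, hr, hra⟩ := Finset.mem_image.1 ha
        exact ⟨r, Finset.mem_filter.2 ⟨hr, hra⟩⟩
      obtain ⟨r, hr, hmin⟩ := Finset.exists_min_image _ Prod.fst hne
      obtain ⟨hrF, rfl⟩ := Finset.mem_filter.1 hr
      obtain ⟨k, i, hk, hi⟩ := (hreal [] r).1 (hF r hrF)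
      obtain ⟨G, hGW, hGsum⟩ := hfin r.2 i
      refine ⟨G, hGW, le_trans ?_ (hi.trans_eq hGsum)⟩
      have hinj : Set.InjOn Prod.fst (F.filter fun s => s.2 = r.2 : Set (ℕ × Word)) := by
        intro s hs t ht hst
        have hs' := (Finset.mem_filter.1 (Finset.mem_coe.1 hs)).2
        have ht' := (Finset.mem_filter.1 (Finset.mem_coe.1 ht)).2
        exact Prod.ext hst (hs'.trans ht'.symm)
      rw [← Finset.sum_image (f := fun n => (1 / 2 : ℝ) ^ n) hinj]
      refine sum_half_pow_le _ k fun n hn => ?_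
      obtain ⟨s, hs, rfl⟩ := Finset.mem_image.1 hn
      exact hk ▸ hmin s hs
    choose! G hGW hGsum using hG
    have hdisj : Set.PairwiseDisjoint (F.image Prod.snd : Set Word) G := by
      intro a ha a' ha' hne
      refine Finset.disjoint_left.2 fun p hp hp' => hne ?_
      exact (hpf p p a a' (hGW a ha p hp) (hGW a' ha' p hp') (List.prefix_refl p)).2
    rw [← Finset.sum_fiberwise_of_maps_to (fun r hr => Finset.mem_image_of_mem Prod.snd hr)]
    refine (Finset.sum_le_sum hGsum).trans ?_
    rw [← Finset.sum_biUnion hdisj]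
    refine kraft_of_prefixFree _ fun p hp p' hp' hpre => ?_
    obtain ⟨a, ha, hap⟩ := Finset.mem_biUnion.1 hp
    obtain ⟨a', ha', hap'⟩ := Finset.mem_biUnion.1 hp'
    exact (hpf p p' a a' (hGW a ha p hap) (hGW a' ha' p' hap') hpre).1
  refine ⟨c + 2, fun a F hF => ?_⟩
  rcases F.eq_empty_or_nonempty with rfl | hne
  · simp
  have hpos : 0 < ∑ p ∈ F, (1 / 2 : ℝ) ^ p.length :=
    Finset.sum_pos (fun _ _ => by positivity) hne
  have hle : ∑ p ∈ F, (1 / 2 : ℝ) ^ p.length ≤ 1 :=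
    kraft_of_prefixFree F fun p hp p' hp' hpre => (hpf p p' a a (hF p hp) (hF p' hp') hpre).1
  -- The weight lies in `(2^{-(k+1)}, 2^{-k}]`, so the request of length `k + 2` is made.
  obtain ⟨k, hk, hk'⟩ := exists_nat_pow_near_of_lt_one hpos hle
    (by norm_num : (0 : ℝ) < 1 / 2) (by norm_num)
  obtain ⟨i, hi⟩ := hcof a F hF
  have hK : plainK U a ≤ k + 2 + c := hc [] hkraft (k + 1 + 1) a
    ((hreal [] (k + 1 + 1, a)).2 ⟨k + 1, i, rfl, hk.le.trans hi⟩)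
  calc (∑ p ∈ F, (1 / 2 : ℝ) ^ p.length) * 2 ^ plainK U a
      ≤ (1 / 2) ^ k * 2 ^ (k + 2 + c) := by
        gcongr
        norm_num
    _ = 2 ^ (c + 2) := by
        rw [show k + 2 + c = k + (c + 2) by omega, pow_add 2 k, ← mul_assoc, ← mul_pow]
        norm_num

/-- The hard half of the chain rule for prefix complexity. -/
theorem exists_add_condK_star_le_plainK :
    ∃ c : ℕ, ∀ a b, plainK U a + condK U b (star U a) ≤ plainK U (pairWord a b) + c := by
  classical
  let W : Word → Word → Prop := fun a p => ∃ b, pairWord a b ∈ U p []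
  obtain ⟨c₀, hc₀⟩ := hU.exists_sum_mul_two_pow_plainK_le (W := W) (by
    refine IsRE.ex (R := fun (q : Word × Word) b => pairWord q.1 b ∈ U q.2 []) ?_
    exact hU.isPrefixMachine.isRE.comp
      (f := fun q : (Word × Word) × Word => ((q.1.2, []), pairWord q.1.1 q.2))
      (((Primrec.snd.comp Primrec.fst).pair (Primrec.const [])).pair
        (primrec_pairWord.comp (Primrec.fst.comp Primrec.fst) Primrec.snd))) (by
    rintro p p' a a' ⟨b, hb⟩ ⟨b', hb'⟩ hpre
    obtain ⟨rfl, h⟩ := hU.isPrefixMachine.eq_of_prefix hb hb' hpre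
    exact ⟨rfl, (pairWord_injective2 h).1⟩)
  -- For `y = a*`, each program `w.2` of a pair `(a,b)` requests `b` with length `|w.2| - K(a) +
  -- c₀`. The coding theorem for `W` says exactly that these requests satisfy Kraft.
  let R : Word → ℕ × Word → Prop := fun y r =>
    ∃ w : Word × Word, w.1 ∈ U y [] ∧ pairWord w.1 r.2 ∈ U w.2 [] ∧
      w.2.length + c₀ = r.1 + y.length
  obtain ⟨c, hc⟩ := hU.exists_condK_le_of_kraft (R := R) (by
    refine IsRE.ex (R := fun (q : Word × (ℕ × Word)) (w : Word × Word) =>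
      w.1 ∈ U q.1 [] ∧ pairWord w.1 q.2.2 ∈ U w.2 [] ∧ w.2.length + c₀ = q.2.1 + q.1.length) ?_
    have hy : Primrec fun r : (Word × (ℕ × Word)) × (Word × Word) => r.1.1 :=
      Primrec.fst.comp Primrec.fst
    have hl : Primrec fun r : (Word × (ℕ × Word)) × (Word × Word) => r.1.2.1 :=
      Primrec.fst.comp (Primrec.snd.comp Primrec.fst)
    have hb : Primrec fun r : (Word × (ℕ × Word)) × (Word × Word) => r.1.2.2 :=
      Primrec.snd.comp (Primrec.snd.comp Primrec.fst)
    have ha : Primrec fun r : (Word × (ℕ × Word)) × (Word × Word) => r.2.1 :=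
      Primrec.fst.comp Primrec.snd
    have hp : Primrec fun r : (Word × (ℕ × Word)) × (Word × Word) => r.2.2 :=
      Primrec.snd.comp Primrec.snd
    refine IsRE.and ?_ (IsRE.and ?_ ?_)
    · exact hU.isPrefixMachine.isRE.comp ((hy.pair (Primrec.const [])).pair ha)
    · exact hU.isPrefixMachine.isRE.comp
        ((hp.pair (Primrec.const [])).pair (primrec_pairWord.comp ha hb))
    · exact IsRE.of_primrecPred (Primrec.eq.comp
        (Primrec.nat_add.comp (Primrec.list_length.comp hp) (Primrec.const c₀))
        (Primrec.nat_add.comp hl (Primrec.list_length.comp hy))))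
  refine ⟨c₀ + c, fun a b => ?_⟩
  have hkraft : ∀ F : Finset (ℕ × Word), (∀ r ∈ F, R (star U a) r) →
      ∑ r ∈ F, (1 / 2 : ℝ) ^ r.1 ≤ 1 := by
    intro F hF
    have hprog : ∀ r ∈ F, ∃ p, pairWord a r.2 ∈ U p [] ∧
        p.length + c₀ = r.1 + plainK U a := by
      intro r hr
      obtain ⟨⟨a', p⟩, ha', hp, hl⟩ := hF r hr
      obtain rfl : a' = a := Part.mem_unique ha' (hU.star_mem a)
      exact ⟨p, hp, hU.length_star a' ▸ hl⟩
    choose! prog hprog hlen using hprog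
    -- A program determines its request: `b` through its output, the length through its own length.
    have hinj : Set.InjOn prog (F : Set (ℕ × Word)) := by
      intro r hr s hs hrs
      have h2 := (pairWord_injective2 (Part.mem_unique (hprog r hr)
        (hrs ▸ hprog s hs))).2
      have h1 := hlen r hr
      rw [hrs, hlen s hs] at h1
      exact Prod.ext (by omega) h2
    have hsum := hc₀ a (F.image prog) (fun p hp => by
      obtain ⟨r, hr, rfl⟩ := Finset.mem_image.1 hp
      exact ⟨r.2, hprog r hr⟩)
    rw [Finset.sum_image hinj] at hsum
    have hterm : ∀ r ∈ F, (1 / 2 : ℝ) ^ (prog r).length * 2 ^ plainK U a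
        = (1 / 2) ^ r.1 * 2 ^ c₀ := by
      intro r hr
      rw [one_div, inv_pow, inv_pow, inv_mul_eq_iff_eq_mul₀ (by positivity), mul_left_comm,
        eq_comm, inv_mul_eq_iff_eq_mul₀ (by positivity), ← pow_add, ← pow_add, hlen r hr]
    rw [Finset.sum_mul, Finset.sum_congr rfl hterm, ← Finset.sum_mul] at hsum
    exact le_of_mul_le_mul_right (by simpa using hsum) (by positivity : (0 : ℝ) < 2 ^ c₀)
  obtain ⟨p, hp, hl⟩ := hU.exists_length_eq_condK (pairWord a b) []
  -- The coding theorem for a single program; it prevents truncation in the requested length.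
  have hle : plainK U a ≤ p.length + c₀ := by
    have h1 := hc₀ a {p} (fun q hq => by
      rw [Finset.mem_singleton.1 hq]
      exact ⟨b, hp⟩)
    rw [Finset.sum_singleton, one_div, inv_pow, inv_mul_le_iff₀ (by positivity), ← pow_add] at h1
    exact (pow_le_pow_iff_right₀ (by norm_num)).1 h1
  have hb := hc (star U a) hkraft (p.length + c₀ - plainK U a) b
    ⟨(a, p), hU.star_mem a, hp, by rw [hU.length_star, Nat.sub_add_cancel hle]⟩
  have hl' : p.length = plainK U (pairWord a b) := hl
  omega

end IsUniversalPrefixMachine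

/-! ### The cause-effect graph -/

theorem tupleWord_pair (a b : Word) : tupleWord [a, b] = pairWord a b := rfl

theorem algorithmicMarkov_causeEffectG1_iff (U : Word → Word → Part Word) (c : ℝ)
    (p x q y : Word) : AlgorithmicMarkov U c causeEffectG1 ![p, x, q, y] ↔
      |(plainK U (pairWord p (pairWord x (pairWord q y))) : ℝ)
        - (condK U p (star U []) + condK U x (star U p) + condK U q (star U [])
          + condK U y (star U (pairWord x q)))| ≤ c := by
  have h0 : parentsWord causeEffectG1 ![p, x, q, y] 0 = [] := by
    simp [parentsWord, causeEffectG1, List.finRange_succ, tupleWord]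
  have h1 : parentsWord causeEffectG1 ![p, x, q, y] 1 = p := by
    simp [parentsWord, causeEffectG1, List.finRange_succ, tupleWord]
  have h2 : parentsWord causeEffectG1 ![p, x, q, y] 2 = [] := by
    simp [parentsWord, causeEffectG1, List.finRange_succ, tupleWord]
  have h3 : parentsWord causeEffectG1 ![p, x, q, y] 3 = pairWord x q := by
    simp [parentsWord, causeEffectG1, List.finRange_succ, tupleWord]
  have h4 : tupleWord (List.ofFn ![p, x, q, y])
      = pairWord p (pairWord x (pairWord q y)) := by
    simp [List.ofFn_succ, tupleWord]
  rw [AlgorithmicMarkov, Fin.sum_univ_four, h0, h1, h2, h3, h4]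
  rfl

namespace IsUniversalPrefixMachine

variable {U : Word → Word → Part Word} (hU : IsUniversalPrefixMachine U)
include hU

/-- Under the algorithmic Markov condition, the complexity of cause and effect given their joint
distribution is the sum of the complexities of the two mechanisms' outputs. -/
theorem exists_abs_condK_sub_le {J : Word → Word → Word} (hJ : Computable₂ J)
    (hinj : Function.Injective2 J) (c : ℝ) :
    ∃ C : ℝ, ∀ p x q y, AlgorithmicMarkov U c causeEffectG1 ![p, x, q, y] →
      |(condK U (pairWord x y) (star U (J p q)) : ℝ)
        - (condK U x (star U p) + condK U y (star U (pairWord x q)))| ≤ C := by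
  have hpw := primrec_pairWord.to_comp
  have hp : Computable fun w : (Word × Word) × (Word × Word) => w.1.1 :=
    Computable.fst.comp Computable.fst
  have hx : Computable fun w : (Word × Word) × (Word × Word) => w.1.2 :=
    Computable.snd.comp Computable.fst
  have hq : Computable fun w : (Word × Word) × (Word × Word) => w.2.1 :=
    Computable.fst.comp Computable.snd
  have hy : Computable fun w : (Word × Word) × (Word × Word) => w.2.2 :=
    Computable.snd.comp Computable.snd
  have hjoint : Computable fun w : (Word × Word) × (Word × Word) =>
      pairWord w.1.1 (pairWord w.1.2 (pairWord w.2.1 w.2.2)) :=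
    hpw.comp hp (hpw.comp hx (hpw.comp hq hy))
  have hjoint_inj : Function.Injective fun w : (Word × Word) × (Word × Word) =>
      pairWord w.1.1 (pairWord w.1.2 (pairWord w.2.1 w.2.2)) := by
    rintro ⟨⟨p, x⟩, q, y⟩ ⟨⟨p', x'⟩, q', y'⟩ h
    obtain ⟨rfl, h⟩ := pairWord_injective2 h
    obtain ⟨rfl, h⟩ := pairWord_injective2 h
    obtain ⟨rfl, rfl⟩ := pairWord_injective2 h
    rfl
  have hdesc : Computable fun w : (Word × Word) × (Word × Word) =>
      pairWord (J w.1.1 w.2.1) (pairWord w.1.2 w.2.2) :=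
    hpw.comp (hJ.comp hp hq) (hpw.comp hx hy)
  have hdesc_inj : Function.Injective fun w : (Word × Word) × (Word × Word) =>
      pairWord (J w.1.1 w.2.1) (pairWord w.1.2 w.2.2) := by
    rintro ⟨⟨p, x⟩, q, y⟩ ⟨⟨p', x'⟩, q', y'⟩ h
    obtain ⟨h, h'⟩ := pairWord_injective2 h
    obtain ⟨rfl, rfl⟩ := hinj h
    obtain ⟨rfl, rfl⟩ := pairWord_injective2 h'
    rfl
  obtain ⟨c₁, h₁⟩ := hU.exists_plainK_le hjoint hdesc hjoint_inj
  obtain ⟨c₂, h₂⟩ := hU.exists_plainK_le hdesc hjoint hdesc_inj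
  obtain ⟨c₃, h₃⟩ := hU.exists_plainK_le (F := fun w : Word × Word => pairWord w.1 w.2)
    (G := fun w => J w.1 w.2) hpw hJ pairWord_injective2.uncurry
  obtain ⟨c₄, h₄⟩ := hU.exists_plainK_le (F := fun w : Word × Word => J w.1 w.2)
    (G := fun w => pairWord w.1 w.2) hJ hpw hinj.uncurry
  obtain ⟨c₅, h₅⟩ := hU.exists_plainK_le
    (F := fun w : (Word × Word) × (Word × Word) =>
      pairWord (pairWord w.1.2 w.2.1) (pairWord w.1.1 w.2.2))
    (hpw.comp (hpw.comp hx hq) (hpw.comp hp hy)) hjoint (by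
      rintro ⟨⟨p, x⟩, q, y⟩ ⟨⟨p', x'⟩, q', y'⟩ h
      obtain ⟨h, h'⟩ := pairWord_injective2 h
      obtain ⟨rfl, rfl⟩ := pairWord_injective2 h
      obtain ⟨rfl, rfl⟩ := pairWord_injective2 h'
      rfl)
  obtain ⟨c₆, h₆⟩ := hU.exists_plainK_le
    (F := fun w : (Word × Word) × Word => pairWord w.1.1 (pairWord w.1.2 w.2))
    (G := fun w => pairWord (pairWord w.2 w.1.2) w.1.1)
    (hpw.comp (Computable.fst.comp Computable.fst)
      (hpw.comp (Computable.snd.comp Computable.fst) Computable.snd))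
    (hpw.comp (hpw.comp Computable.snd (Computable.snd.comp Computable.fst))
      (Computable.fst.comp Computable.fst)) (by
      rintro ⟨⟨p, q⟩, x⟩ ⟨⟨p', q'⟩, x'⟩ h
      obtain ⟨rfl, h⟩ := pairWord_injective2 h
      obtain ⟨rfl, rfl⟩ := pairWord_injective2 h
      rfl)
  obtain ⟨d₁, e₁⟩ := hU.exists_plainK_pairWord_le_star
  obtain ⟨d₂, e₂⟩ := hU.exists_add_condK_star_le_plainK
  obtain ⟨d₃, e₃⟩ := hU.exists_condK_pairWord_le_add
  -- The roots of the graph contribute `K(· | ε*)` rather than `K(·)`; these constants convert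
  -- between the two.
  obtain ⟨d₄, e₄⟩ := hU.exists_condK_le_condK_const [] (star U [])
  obtain ⟨d₅, e₅⟩ := hU.exists_condK_le_condK_const (star U []) []
  refine ⟨|c| + (c₁ + c₂ + c₃ + c₄ + c₅ + c₆ + 3 * d₁ + 3 * d₂ + 3 * d₃ + 2 * d₄ + 2 * d₅ : ℕ),
    fun p x q y hM => ?_⟩
  rw [algorithmicMarkov_causeEffectG1_iff, abs_le] at hM
  have hc := le_abs_self c
  -- relations between joint complexities
  have a₁ := h₁ ((p, x), (q, y))
  have a₂ := h₂ ((p, x), (q, y))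
  have a₃ := h₃ (p, q)
  have a₄ := h₄ (p, q)
  have a₅ := h₅ ((p, x), (q, y))
  have a₆ := h₆ ((p, q), x)
  -- the chain rule
  have b₁ := e₁ (J p q) (pairWord x y)
  have b₂ := e₂ (J p q) (pairWord x y)
  have b₃ := e₁ p (pairWord q x)
  have b₄ := e₂ p q
  have b₅ := e₁ (pairWord x q) (pairWord p y)
  have b₆ := e₂ (pairWord x q) p
  -- subadditivity
  have s₁ := e₃ q x (star U p)
  have s₂ := e₃ p y (star U (pairWord x q))
  have s₃ : plainK U (pairWord p q) ≤ plainK U p + plainK U q + d₃ := e₃ p q []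
  have t₁ : condK U p (star U []) ≤ plainK U p + d₄ := e₄ p
  have t₂ : condK U q (star U []) ≤ plainK U q + d₄ := e₄ q
  have t₃ : plainK U p ≤ condK U p (star U []) + d₅ := e₅ p
  have t₄ : plainK U q ≤ condK U q (star U []) + d₅ := e₅ q
  simp only at a₁ a₂ a₃ a₄ a₅ a₆
  -- Split off `(x,q)` and bound the rest by `K(p | (x,q)*) + K(y | (x,q)*)`. Regroup the first of
  -- these with `K(x,q)` into `K(p,q,x)`, then split off `p` to reach `K(p,q) + K(x | p*)`.
  have hsum : plainK U (pairWord p (pairWord x (pairWord q y)))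
      ≤ plainK U (pairWord p q) + condK U x (star U p) + condK U y (star U (pairWord x q))
        + (c₅ + c₆ + 2 * d₁ + 2 * d₂ + 2 * d₃) := by omega
  rify at a₁ a₂ a₃ a₄ b₁ b₂ s₃ t₁ t₂ t₃ t₄ hsum
  push_cast
  have := abs_nonneg c
  have nonneg : ∀ n : ℕ, (0 : ℝ) ≤ n := fun n => n.cast_nonneg
  have n₁ := nonneg c₁
  have n₂ := nonneg c₂
  have n₃ := nonneg c₃
  have n₄ := nonneg c₄
  have n₅ := nonneg c₅
  have n₆ := nonneg c₆
  have m₁ := nonneg d₁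
  have m₂ := nonneg d₂
  have m₃ := nonneg d₃
  have m₄ := nonneg d₄
  have m₅ := nonneg d₅
  rw [abs_le]
  -- The upper bound on `K(x,y | J(p,q)*)` follows from `hsum` and `b₂`; the lower one from `b₁`,
  -- `s₃` and the Markov lower bound on the joint complexity.
  constructor <;> linarith [hM.1, hM.2]

end IsUniversalPrefixMachine

/-! ### Probabilities -/

theorem jointDist_apply {𝒳 𝒴 : Set Word} (P : PMF 𝒳) (Q : 𝒳 → PMF 𝒴) (x : 𝒳) (y : 𝒴) :
    jointDist P Q (x, y) = P x * Q x y := by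
  classical
  rw [jointDist, PMF.bind_apply, tsum_eq_single x]
  · rw [PMF.map_apply, tsum_eq_single y]
    · simp
    · intro y' hy'
      simp [Ne.symm hy']
  · intro x' hx'
    rw [PMF.map_apply]
    simp [Ne.symm hx']

theorem negLog_ne_bot (t : ℝ≥0∞) : negLog t ≠ ⊥ := by
  rw [negLog]
  split_ifs
  · exact top_ne_bot
  · exact EReal.coe_ne_bot _

theorem negLog_mul {s t : ℝ≥0∞} (hs : s ≠ ∞) (ht : t ≠ ∞) :
    negLog (s * t) = negLog s + negLog t := by
  by_cases hs0 : s = 0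
  · rw [hs0, zero_mul, negLog, if_pos rfl, EReal.top_add_of_ne_bot (negLog_ne_bot t)]
  by_cases ht0 : t = 0
  · rw [ht0, mul_zero]
    conv_rhs => rw [add_comm]
    rw [negLog, if_pos rfl, EReal.top_add_of_ne_bot (negLog_ne_bot s)]
  rw [negLog, negLog, negLog, if_neg hs0, if_neg ht0, if_neg (mul_ne_zero hs0 ht0),
    ENNReal.toReal_mul, Real.logb_mul (ENNReal.toReal_ne_zero.2 ⟨hs0, hs⟩)
    (ENNReal.toReal_ne_zero.2 ⟨ht0, ht⟩), ← EReal.coe_add]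
  congr 1
  ring

/-- The complexities are real and `⊥` is excluded, so an infinite `a` or `b` makes both sides `⊤`,
and no `⊤ - ⊤` arises. -/
theorem EReal.add_sub_le_and_le {a b : EReal} (ha : a ≠ ⊥) (hb : b ≠ ⊥) {k m n C : ℝ}
    (h : |k - (m + n)| ≤ C) :
    a + b - k ≤ (a - m) + (b - n) + C ∧ (a - m) + (b - n) ≤ a + b - k + C := by
  rw [abs_le] at h
  induction a with
  | bot => exact absurd rfl ha
  | top =>
    induction b with
    | bot => exact absurd rfl hb
    | top => simp
    | coe b => simp [← EReal.coe_sub]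
  | coe a =>
    induction b with
    | bot => exact absurd rfl hb
    | top => simp [← EReal.coe_sub]
    | coe b =>
      norm_cast
      constructor <;> linarith [h.1, h.2]

theorem mainTheorem3
    (U : Word → Word → Part Word) (hU : IsUniversalPrefixMachine U)
    (J : Word → Word → Word) (hJ : IsJointDescription J) (c : ℝ) :
    ∃ C : ℝ, ∀ (𝒳 𝒴 : Set Word) (P : PMF 𝒳) (Q : 𝒳 → PMF 𝒴) (p q : Word),
      DescribesDist p P → DescribesMechanism q Q →
      ∀ (x : 𝒳) (y : 𝒴),
        AlgorithmicMarkov U c causeEffectG1 ![p, (x : Word), q, (y : Word)] →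
          jointDeficiency U (jointDist P Q) (J p q) x y
              ≤ deficiency U P p x + condDeficiency U Q q x y + (C : EReal) ∧
          deficiency U P p x + condDeficiency U Q q x y
              ≤ jointDeficiency U (jointDist P Q) (J p q) x y + (C : EReal) := by
  obtain ⟨C, hC⟩ := hU.exists_abs_condK_sub_le hJ.computable hJ.injective c
  refine ⟨C, fun 𝒳 𝒴 P Q p q _ _ x y hM => ?_⟩
  rw [jointDeficiency, deficiency, condDeficiency, jointDist_apply,
    negLog_mul (P.apply_ne_top x) ((Q x).apply_ne_top y), tupleWord_pair, tupleWord_pair]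
  exact EReal.add_sub_le_and_le (negLog_ne_bot _) (negLog_ne_bot _) (hC p x q y hM)
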